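/- Let $d\in\{3,4\}$ and let $X$ be a connected, finite, simple $d$-valent graph with an orientation at each vertex, i.e. for each vertex $p$ the $d$ edges emanating from $p$ are ordered. For an integer $k\ge 1$ the Goldberg–Coxeter construction $\mathrm{GC}_{k,0}(X)$ is the following $d$-valent graph. If $d=3$, put $\omega=e^{\pi i/3}$ and let $P_k$ be the triangle with corners $0,k,k\omega$, which consists of $k^2$ small triangles of the lattice $\mathbb Z[\omega]$; if $d=4$, let $P_k$ be the square with corners $0,k,(1+i)k,ik$, which consists of $k^2$ small squares of the lattice $\mathbb Z[i]$. Take one copy $P_k(p)$ of $P_k$ for each vertex $p$ of $X$ and let the edges emanating from $p$, in their given order, correspond to the sides of $P_k(p)$ in counterclockwise order. For each edge $pq$ of $X$ glue the side of $P_k(p)$ corresponding to $pq$ isometrically to the side of $P_k(q)$ corresponding to $pq$, so that the counterclockwise orientations of the two boundaries induce opposite directions on the common side. The vertices of $\mathrm{GC}_{k,0}(X)$ are the $k^2|V(X)|$ small triangles (resp. squares), and two of them are adjacent if they share an edge inside some $P_k(p)$ or along a glued side. The Laplacian of a finite graph $G$ is $(\Delta_G f)(p)=\deg(p)f(p)-\sum_{q\sim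 p}f(q)$. Let $\lambda_1(k)\le\lambda_2(k)\le\dots\le\lambda_{N_k}(k)$, $N_k=k^2|V(X)|$, be the eigenvalues, with multiplicity, of the Laplacian of $\mathrm{GC}_{k,0}(X)$. Let $(m_k)_{k\ge1}$ be any sequence of nonnegative integers with $m_k/k^2\to 0$ as $k\to\infty$. Then the first $m_k$ eigenvalues of $\mathrm{GC}_{k,0}(X)$ tend to $0$ and the last $m_k$ tend to $2d$ (that is, to $6$ if $d=3$ and to $8$ if $d=4$) as $k\to\infty$: for every $\varepsilon>0$ there is $K$ such that for all $k\ge K$ $$|\lambda_j(k)|<\varepsilon\quad(1\le j\le \min(m_k,N_k)),\qquad |\lambda_j(k)-2d|<\varepsilon\quad(\max(1,N_k-m_k+1)\le j\le N_k).$$ -/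

import Mathlib

open Filter Topology

/-- An orientation at each vertex of a `d`-valent simple graph: the `d` edges emanating from each
vertex `p`, named by their other endpoints, are ordered as `nbr p 0, …, nbr p (d - 1)`.
The existence of such a numbering says in particular that every vertex has degree `d`. -/
structure VertexOrientation {V : Type*} (X : SimpleGraph V) (d : ℕ) where
  nbr : ∀ p : V, Fin d ≃ X.neighborSet p

/-- Gluing of one copy of a polygonal tile with `d` sides for each vertex of `X`. The graph `T`
on `C` records which cells of the tile are neighbours, and `side i t` is the `t`-th of the `k`
cells of the tile along its `i`-th side; the sides are numbered in counterclockwise order and each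
side is traversed counterclockwise. The `i`-th side of the tile of `p` belongs to the `i`-th edge at
`p`. If the edge `pq` is the `i`-th one at `p` and the `j`-th one at `q`, these two sides are
glued so that they are traversed in opposite directions, and cells which meet along them become
neighbours. -/
def glueTiles {V : Type*} {X : SimpleGraph V} {d k : ℕ} (o : VertexOrientation X d)
    {C : Type*} (T : SimpleGraph C) (side : Fin d → Fin k → C) : SimpleGraph (V × C) where
  Adj x y :=
    (x.1 = y.1 ∧ T.Adj x.2 y.2) ∨
      ∃ (i j : Fin d) (t : Fin k),
        (o.nbr x.1 i : V) = y.1 ∧ (o.nbr y.1 j : V) = x.1 ∧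
          x.2 = side i t ∧ y.2 = side j t.rev
  symm := ⟨by
    rintro x y (⟨h, h'⟩ | ⟨i, j, t, h₁, h₂, h₃, h₄⟩)
    · exact Or.inl ⟨h.symm, h'.symm⟩
    · exact Or.inr ⟨j, i, t.rev, h₂, h₁, h₄, by simpa using h₃⟩⟩
  loopless := ⟨by
    rintro x (⟨_, h⟩ | ⟨i, j, t, h₁, _⟩)
    · exact T.loopless.irrefl _ h
    · have h := (o.nbr x.1 i).2
      rw [SimpleGraph.mem_neighborSet, h₁] at h
      exact X.loopless.irrefl _ h⟩

/-- The `k ^ 2` small triangles of the triangular lattice `ℤ[ω]`, `ω = exp (π i / 3)`, inside the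
triangle with corners `0`, `k`, `k ω`. A point of that triangle is
`(y₀ * 0 + y₁ * k + y₂ * (k ω)) / k` with `y₀, y₁, y₂ ≥ 0` and `y₀ + y₁ + y₂ = k`,
and a small triangle is given by the common integer parts `x i = ⌊y i⌋` of its interior points:
* `x 0 + x 1 + x 2 = k - 1`: the upward triangle with vertices
  `a + b ω`, `a + 1 + b ω`, `a + (b + 1) ω`, where `(a, b) = (x 1, x 2)`;
* `x 0 + x 1 + x 2 = k - 2`: the downward triangle with vertices
  `a + b ω`, `a + (b + 1) ω`, `a - 1 + (b + 1) ω`, where `(a, b) = (x 1 + 1, x 2)`. -/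
abbrev TriCell (k : ℕ) : Type :=
  {x : Fin 3 → Fin k // (∑ i, (x i : ℕ)) + 1 = k ∨ (∑ i, (x i : ℕ)) + 2 = k}

/-- Two small triangles in the triangle `(0, k, k ω)` are neighbours if they share an edge, i.e. if
exactly one of the three integer parts changes, and it changes by one. -/
def triTile (k : ℕ) : SimpleGraph (TriCell k) :=
  SimpleGraph.fromRel fun c c' =>
    ∃ i : Fin 3, ∀ j : Fin 3, (c'.1 j : ℕ) = (c.1 j : ℕ) + if j = i then 1 else 0

/-- Side `i` of the triangle is opposite to the corner `i`, where the corners `0, 1, 2` are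
`0, k, k ω`, and runs from the corner `i + 1` to the corner `i + 2` (indices modulo `3`). The `t`-th
cell along it has `x i = 0`, `x (i + 1) = k - 1 - t`, `x (i + 2) = t`. -/
def triSide (k : ℕ) (i : Fin 3) (t : Fin k) : TriCell k :=
  ⟨fun j => if j = i then ⟨0, t.pos⟩ else if j = i + 1 then t.rev else t, by
    left
    have := t.isLt
    fin_cases i <;> simp [Fin.sum_univ_three] <;> omega⟩

/-- The cell `(a, b)` is the small square of `ℤ[i]` with vertices
`a + b i`, `(a + 1) + b i`, `(a + 1) + (b + 1) i`, `a + (b + 1) i`, inside the square with corners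
`0`, `k`, `(1 + i) k`, `i k`. -/
abbrev SquareCell (k : ℕ) : Type := Fin k × Fin k

/-- Two small squares are neighbours if they share an edge: this is the `k × k` grid graph. -/
def squareTile (k : ℕ) : SimpleGraph (SquareCell k) :=
  SimpleGraph.boxProd (SimpleGraph.pathGraph k) (SimpleGraph.pathGraph k)

/-- The sides `0, 1, 2, 3` of the square are the right one (traversed upwards), the upper one
(leftwards), the left one (downwards) and the lower one (rightwards). -/
def squareSide (k : ℕ) (i : Fin 4) (t : Fin k) : SquareCell k :=
  ![((⟨0, t.pos⟩ : Fin k).rev, t), (t.rev, (⟨0, t.pos⟩ : Fin k).rev),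
    (⟨0, t.pos⟩, t.rev), (t, ⟨0, t.pos⟩)] i

/-- The Goldberg-Coxeter construction `GC_{k,0}(X)` of a `3`-valent graph `X` with an orientation at
each vertex. As the second parameter is `0`, the small triangles meeting the interior of the
triangle `(0, k, k ω)` are the ones inside it, so the tiles do not overlap. -/
def goldbergCoxeter3 {V : Type*} {X : SimpleGraph V} (o : VertexOrientation X 3) (k : ℕ) :
    SimpleGraph (V × TriCell k) :=
  glueTiles o (triTile k) (triSide k)

/-- The Goldberg-Coxeter construction `GC_{k,0}(X)` of a `4`-valent graph `X` with an orientation at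
each vertex. -/
def goldbergCoxeter4 {V : Type*} {X : SimpleGraph V} (o : VertexOrientation X 4) (k : ℕ) :
    SimpleGraph (V × SquareCell k) :=
  glueTiles o (squareTile k) (squareSide k)

open Classical in
/-- The eigenvalues of the combinatorial Laplacian `Δ f p = deg p * f p - ∑_{q ∼ p} f q` of a finite
graph with `n` vertices, listed with multiplicity in nondecreasing order as
`laplacianEigenvalue G 0 ≤ … ≤ laplacianEigenvalue G (n - 1)`. -/
noncomputable def laplacianEigenvalue {W : Type*} [Fintype W] (G : SimpleGraph W)
    (j : Fin (Fintype.card W)) : ℝ :=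
  Matrix.IsHermitian.eigenvalues₀ (A := G.lapMatrix ℝ)
    (SimpleGraph.posSemidef_lapMatrix ℝ G).isHermitian j.rev

/-- The first `m k` Laplacian eigenvalues of `G k` tend to `a` (uniformly) as `k → ∞`. -/
def FirstEigenvaluesTendTo {W : ℕ → Type*} [∀ k, Fintype (W k)] (G : ∀ k, SimpleGraph (W k))
    (m : ℕ → ℕ) (a : ℝ) : Prop :=
  ∀ ε > 0, ∀ᶠ k in atTop, ∀ j : Fin (Fintype.card (W k)),
    (j : ℕ) < m k → |laplacianEigenvalue (G k) j - a| < ε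

/-- The last `m k` Laplacian eigenvalues of `G k` tend to `a` (uniformly) as `k → ∞`. -/
def LastEigenvaluesTendTo {W : ℕ → Type*} [∀ k, Fintype (W k)] (G : ∀ k, SimpleGraph (W k))
    (m : ℕ → ℕ) (a : ℝ) : Prop :=
  ∀ ε > 0, ∀ᶠ k in atTop, ∀ j : Fin (Fintype.card (W k)),
    (j.rev : ℕ) < m k → |laplacianEigenvalue (G k) j - a| < ε

/-! Small eigenvalues come from a min-max argument with many test functions of disjoint support. Fix
`n` and pack `⌊k / (2n)⌋²` disjoint blocks of side `n` into a single tile. Functions constant on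
each block and zero elsewhere form a space of that dimension. Their energy comes only from edges
with no end at an inner cell of a block; a block has on the order of `n²` cells but at most `4n`
boundary cells, so the Rayleigh quotient is at most `16d / n`, uniformly in `k`. Since `m k =
o(k²)`, the dimension eventually exceeds `m k`, and then `n` can be taken large.

The top of the spectrum is symmetric: the blocks are bipartite, and multiplying by the bipartition
sign turns the form of `2d - Δ` into a sum of squares `(f x + f y)²`, plus a term for missing
degree, that is small for the same reason. Positivity and degrees at most `d` confine the spectrum
to `[0, 2d]`.

`BlockFamily` abstracts the packing, `sq_add_mul_blockFun_le` is the edgewise estimate for both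
signs, and `BlockFamily.eigenvaluesTendTo` is the limit argument; the triangle and the square only
have to supply blocks and degree bounds. -/

open Matrix Module

/-! ### Min-max bounds for Laplacian eigenvalues -/

/-- One half of the Courant–Fischer principle, as a dimension count: a subspace on which the
quadratic form of `A` is at most `c` meets the span of the eigenvectors with eigenvalues above `c`
trivially. -/
theorem Matrix.card_add_finrank_le_of_forall_dotProduct_le {ι W : Type*} [DecidableEq ι]
    [Fintype W] (A : Matrix W W ℝ) {v : ι → W → ℝ} {μ : ι → ℝ} {c : ℝ} (s : Finset ι)
    (hv : ∀ i ∈ s, ∀ j ∈ s, v i ⬝ᵥ v j = if i = j then 1 else 0)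
    (hA : ∀ i, A *ᵥ v i = μ i • v i) (hs : ∀ i ∈ s, c < μ i) (U : Submodule ℝ (W → ℝ))
    (hU : ∀ f ∈ U, f ⬝ᵥ A *ᵥ f ≤ c * (f ⬝ᵥ f)) :
    s.card + finrank ℝ U ≤ Fintype.card W := by
  classical
  let T : (s → ℝ) →ₗ[ℝ] (W → ℝ) := Fintype.linearCombination ℝ fun i : s => v i
  have hT : ∀ a, T a = ∑ i, a i • v i := fun a => Fintype.linearCombination_apply ..
  have hAT : ∀ a, A *ᵥ T a = ∑ i, (a i * μ i) • v i := fun a => by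
    simp only [hT, Matrix.mulVec_sum, Matrix.mulVec_smul, hA, smul_smul]
  have hdot : ∀ a b : s → ℝ, (∑ i, a i • v i) ⬝ᵥ (∑ i, b i • v i) = ∑ i, a i * b i := by
    intro a b
    simp only [sum_dotProduct, dotProduct_sum, smul_dotProduct, dotProduct_smul, smul_eq_mul]
    refine Finset.sum_congr rfl fun i _ => ?_
    rw [Finset.sum_eq_single i]
    · simp [hv i i.2 i i.2, mul_comm]
    · intro j _ hj
      rw [hv j j.2 i i.2, if_neg fun h => hj (Subtype.ext h)]
      simp
    · simp
  -- Used twice: for injectivity of `T`, because `0 ∈ U`, and for disjointness of its range from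
  -- `U`.
  have key : ∀ a, T a ∈ U → a = 0 := by
    intro a ha
    have h := hU _ ha
    rw [hAT, hT, hdot, hdot, Finset.mul_sum] at h
    have h0 : ∑ i, (a i) ^ 2 * (μ i - c) ≤ 0 := by
      have : ∑ i, (a i) ^ 2 * (μ i - c) = ∑ i, a i * (a i * μ i) - ∑ i, c * (a i * a i) := by
        rw [← Finset.sum_sub_distrib]
        exact Finset.sum_congr rfl fun i _ => by ring
      linarith
    have hnn : ∀ i ∈ Finset.univ, 0 ≤ (a i) ^ 2 * (μ i - c) := fun i _ =>
      mul_nonneg (sq_nonneg _) (sub_nonneg.2 (hs i i.2).le)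
    have h1 := (Finset.sum_eq_zero_iff_of_nonneg hnn).1 (le_antisymm h0 (Finset.sum_nonneg hnn))
    funext i
    rcases mul_eq_zero.1 (h1 i (Finset.mem_univ i)) with h2 | h2
    · exact pow_eq_zero_iff two_ne_zero |>.1 h2
    · exact absurd (hs i i.2) (by linarith)
  have hinj : Function.Injective T := by
    rw [← LinearMap.ker_eq_bot, LinearMap.ker_eq_bot']
    exact fun a ha => key a (ha ▸ U.zero_mem)
  have hdisj : Disjoint (LinearMap.range T) U := by
    rw [Submodule.disjoint_def]
    rintro _ ⟨a, rfl⟩ ha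
    rw [key a ha, map_zero]
  have := Submodule.finrank_add_finrank_le_of_disjoint hdisj
  rwa [LinearMap.finrank_range_of_inj hinj, finrank_fintype_fun_eq_card, Fintype.card_coe,
    finrank_fintype_fun_eq_card] at this

/-- An orthonormal system of eigenvectors, numbered like the eigenvalues. -/
theorem exists_laplacian_eigenvectors {W : Type*} [Fintype W] [DecidableEq W]
    (G : SimpleGraph W) [DecidableRel G.Adj] :
    ∃ v : Fin (Fintype.card W) → W → ℝ, (∀ i j, v i ⬝ᵥ v j = if i = j then 1 else 0) ∧
      ∀ i, G.lapMatrix ℝ *ᵥ v i = laplacianEigenvalue G i • v i := by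
  let hA := (SimpleGraph.posSemidef_lapMatrix ℝ G).isHermitian
  -- The same equivalence by which `eigenvalues` reindexes `eigenvalues₀`, so eigenvectors and
  -- sorted eigenvalues match.
  let e := Fintype.equivOfCardEq (Fintype.card_fin (Fintype.card W))
  refine ⟨fun i => (hA.eigenvectorBasis (e i.rev)).ofLp, fun i j => ?_, fun i => ?_⟩
  · have h := orthonormal_iff_ite.1 hA.eigenvectorBasis.orthonormal (e j.rev) (e i.rev)
    rw [EuclideanSpace.inner_eq_star_dotProduct, star_trivial] at h
    simpa [eq_comm] using h
  · rw [hA.mulVec_eigenvectorBasis, IsHermitian.eigenvalues, Equiv.symm_apply_apply]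
    congr 1
    unfold laplacianEigenvalue
    congr!

open Classical in
theorem laplacianEigenvalue_monotone {W : Type*} [Fintype W] (G : SimpleGraph W) :
    Monotone (laplacianEigenvalue G) := fun _ _ h =>
  Matrix.IsHermitian.eigenvalues₀_antitone _ (Fin.rev_le_rev.2 h)

/-- Otherwise the `card W - j` eigenvectors from index `j` on all have eigenvalue above `c`, and
together with `U` they need more than `card W` dimensions. -/
theorem laplacianEigenvalue_le {W : Type*} [Fintype W] (G : SimpleGraph W) [DecidableEq W]
    [DecidableRel G.Adj] (U : Submodule ℝ (W → ℝ)) {c : ℝ}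
    (hU : ∀ f ∈ U, f ⬝ᵥ G.lapMatrix ℝ *ᵥ f ≤ c * (f ⬝ᵥ f)) (j : Fin (Fintype.card W))
    (hj : (j : ℕ) < finrank ℝ U) : laplacianEigenvalue G j ≤ c := by
  by_contra! hc
  obtain ⟨v, hv, hA⟩ := exists_laplacian_eigenvectors G
  have := card_add_finrank_le_of_forall_dotProduct_le (G.lapMatrix ℝ) (Finset.Ici j)
    (fun i _ j _ => hv i j) hA
    (fun i hi => hc.trans_le (laplacianEigenvalue_monotone G (Finset.mem_Ici.1 hi))) U hU
  rw [Fin.card_Ici] at this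
  omega

/-- The same count for the negated Laplacian and the indices up to `j`. -/
theorem le_laplacianEigenvalue {W : Type*} [Fintype W] (G : SimpleGraph W) [DecidableEq W]
    [DecidableRel G.Adj] (U : Submodule ℝ (W → ℝ)) {c : ℝ}
    (hU : ∀ f ∈ U, c * (f ⬝ᵥ f) ≤ f ⬝ᵥ G.lapMatrix ℝ *ᵥ f) (j : Fin (Fintype.card W))
    (hj : (j.rev : ℕ) < finrank ℝ U) : c ≤ laplacianEigenvalue G j := by
  by_contra! hc
  obtain ⟨v, hv, hA⟩ := exists_laplacian_eigenvectors G
  have := card_add_finrank_le_of_forall_dotProduct_le (c := -c) (-G.lapMatrix ℝ)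
    (Finset.Iic j) (fun i _ j _ => hv i j) (μ := fun i => -laplacianEigenvalue G i)
    (fun i => by rw [neg_mulVec, hA, neg_smul])
    (fun i hi => neg_lt_neg
      ((laplacianEigenvalue_monotone G (Finset.mem_Iic.1 hi)).trans_lt hc)) U
    (fun f hf => by
      rw [neg_mulVec, dotProduct_neg, neg_mul]
      exact neg_le_neg (hU f hf))
  rw [Fin.card_Iic] at this
  rw [Fin.val_rev] at hj
  omega

theorem laplacianEigenvalue_nonneg {W : Type*} [Fintype W] (G : SimpleGraph W)
    (j : Fin (Fintype.card W)) : 0 ≤ laplacianEigenvalue G j := by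
  classical
  refine le_laplacianEigenvalue G ⊤ (fun f _ => ?_) j ?_
  · simpa using (SimpleGraph.posSemidef_lapMatrix ℝ G).dotProduct_mulVec_nonneg f
  · simp only [finrank_top, finrank_fintype_fun_eq_card]
    exact j.rev.isLt

/-! ### The quadratic forms of `Δ` and `2d - Δ` -/

section QuadraticForm

variable {W : Type*} [Fintype W] (G : SimpleGraph W) [DecidableRel G.Adj]

theorem dotProduct_lapMatrix_mulVec [DecidableEq W] (f : W → ℝ) : f ⬝ᵥ G.lapMatrix ℝ *ᵥ f =
    (∑ x, ∑ y, if G.Adj x y then (f x - f y) ^ 2 else 0) / 2 := by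
  rw [← SimpleGraph.lapMatrix_toLinearMap₂', toLinearMap₂'_apply']

theorem sum_sum_adj_left (g : W → ℝ) :
    (∑ x, ∑ y, if G.Adj x y then g x else 0) = ∑ x, G.degree x * g x := by
  refine Finset.sum_congr rfl fun x _ => ?_
  rw [G.degree_eq_sum_if_adj, Finset.sum_mul]
  simp

theorem sum_sum_adj_right (g : W → ℝ) :
    (∑ x, ∑ y, if G.Adj x y then g y else 0) = ∑ x, G.degree x * g x := by
  rw [Finset.sum_comm, ← sum_sum_adj_left]
  simp only [G.adj_comm]

/-- Sum `(a + b)² + (a - b)² = 2a² + 2b²` over ordered adjacent pairs; the first sum corrects for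
vertices whose degree is not `d`. -/
theorem signless_quadraticForm [DecidableEq W] (d : ℝ) (f : W → ℝ) :
    2 * d * (f ⬝ᵥ f) - f ⬝ᵥ G.lapMatrix ℝ *ᵥ f = (∑ x, 2 * (d - G.degree x) * f x ^ 2) +
      (∑ x, ∑ y, if G.Adj x y then (f x + f y) ^ 2 else 0) / 2 := by
  have h : (∑ x, ∑ y, if G.Adj x y then (f x + f y) ^ 2 else 0) +
      (∑ x, ∑ y, if G.Adj x y then (f x - f y) ^ 2 else 0) =
      2 * (∑ x, G.degree x * f x ^ 2) + 2 * ∑ x, G.degree x * f x ^ 2 := by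
    conv_rhs => rw [← sum_sum_adj_left]
    conv_rhs => enter [2]; rw [sum_sum_adj_left, ← sum_sum_adj_right]
    simp only [Finset.mul_sum, ← Finset.sum_add_distrib]
    refine Finset.sum_congr rfl fun x _ => Finset.sum_congr rfl fun y _ => ?_
    split_ifs <;> ring
  have h2 : (∑ x, 2 * (d - G.degree x) * f x ^ 2) =
      2 * d * (f ⬝ᵥ f) - 2 * ∑ x, G.degree x * f x ^ 2 := by
    rw [dotProduct, Finset.mul_sum, Finset.mul_sum, ← Finset.sum_sub_distrib]
    exact Finset.sum_congr rfl fun x _ => by ring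
  rw [dotProduct_lapMatrix_mulVec, h2]
  linarith

/-- Each vertex is charged at most `d` times as first and `d` times as second end of an ordered
pair. -/
theorem sum_sum_adj_le {g : W → ℝ} {q : W → W → ℝ} {d : ℕ} (hd : ∀ x, G.degree x ≤ d)
    (hg : ∀ x, 0 ≤ g x) (h : ∀ x y, G.Adj x y → q x y ≤ 2 * (g x + g y)) :
    (∑ x, ∑ y, if G.Adj x y then q x y else 0) / 2 ≤ 2 * d * ∑ x, g x := by
  have h1 : (∑ x, ∑ y, if G.Adj x y then q x y else 0) ≤
      2 * ((∑ x, ∑ y, if G.Adj x y then g x else 0) +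
        ∑ x, ∑ y, if G.Adj x y then g y else 0) := by
    simp only [Finset.mul_sum, ← Finset.sum_add_distrib]
    refine Finset.sum_le_sum fun x _ => Finset.sum_le_sum fun y _ => ?_
    split_ifs with hxy
    · exact h x y hxy
    · simp
  rw [sum_sum_adj_left, sum_sum_adj_right] at h1
  have h2 : ∑ x, (G.degree x : ℝ) * g x ≤ d * ∑ x, g x := by
    rw [Finset.mul_sum]
    exact Finset.sum_le_sum fun x _ =>
      mul_le_mul_of_nonneg_right (Nat.cast_le.2 (hd x)) (hg x)
  linarith

end QuadraticForm

theorem laplacianEigenvalue_le_two_mul {W : Type*} [Fintype W] (G : SimpleGraph W)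
    [DecidableRel G.Adj] {d : ℕ} (hd : ∀ x, G.degree x ≤ d) (j : Fin (Fintype.card W)) :
    laplacianEigenvalue G j ≤ 2 * d := by
  classical
  refine laplacianEigenvalue_le G ⊤ (fun f _ => ?_) j ?_
  · rw [← sub_nonneg, signless_quadraticForm]
    refine add_nonneg (Finset.sum_nonneg fun x _ => ?_) (div_nonneg
      (Finset.sum_nonneg fun x _ => Finset.sum_nonneg fun y _ => ?_) zero_le_two)
    · have : (G.degree x : ℝ) ≤ d := Nat.cast_le.2 (hd x)
      exact mul_nonneg (by linarith) (sq_nonneg _)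
    · split_ifs <;> positivity
  · simp only [finrank_top, finrank_fintype_fun_eq_card]
    exact j.isLt

/-! ### Block families and their test functions -/

/-- Copies, indexed by `B`, of a bipartite pattern `S` in a graph: away from the exceptional set
`bad`, each vertex of a copy has `d` neighbours inside the copy, all of the opposite sign. -/
structure BlockFamily {W : Type*} (G : SimpleGraph W) (d : ℕ) (B S : Type*) where
  cell : B × S → W
  cell_injective : Function.Injective cell
  sign : S → ℝ
  sign_sq : ∀ s, sign s ^ 2 = 1
  bad : Finset S
  nbr : S → Fin d → S
  nbr_injective : ∀ s ∉ bad, Function.Injective (nbr s)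
  adj : ∀ b, ∀ s ∉ bad, ∀ i, G.Adj (cell (b, s)) (cell (b, nbr s i))
  sign_nbr : ∀ s ∉ bad, ∀ i, sign (nbr s i) = -sign s

theorem sum_extend_zero {α β : Type*} [Fintype α] [Fintype β] {e : α → β}
    (he : Function.Injective e) (h : α → ℝ) : ∑ x, Function.extend e h 0 x = ∑ a, h a := by
  classical
  rw [← Finset.sum_subset (Finset.subset_univ (Finset.univ.image e)),
    Finset.sum_image fun a _ b _ hab => he hab]
  · simp only [he.extend_apply]
  · intro x _ hx
    rw [Function.extend_apply' _ _ _ (by simpa using hx), Pi.zero_apply]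

namespace BlockFamily

variable {W B S : Type*} {G : SimpleGraph W} {d : ℕ} (E : BlockFamily G d B S)

/-- The degree bound leaves no room beyond the `d` distinct neighbours in the copy, so no edge
leaves a copy from an inner vertex. -/
theorem image_nbr [Fintype W] [DecidableEq W] [DecidableRel G.Adj] (hd : ∀ x, G.degree x ≤ d)
    (b : B) {s : S} (hs : s ∉ E.bad) :
    Finset.univ.image (fun i => E.cell (b, E.nbr s i)) = G.neighborFinset (E.cell (b, s)) := by
  have hsub : Finset.univ.image (fun i => E.cell (b, E.nbr s i)) ⊆
      G.neighborFinset (E.cell (b, s)) := by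
    intro y hy
    obtain ⟨i, -, rfl⟩ := Finset.mem_image.1 hy
    simpa using E.adj b s hs i
  refine Finset.eq_of_subset_of_card_le hsub ?_
  rw [Finset.card_image_of_injective, Finset.card_univ, Fintype.card_fin]
  · exact hd _
  · intro i j hij
    exact E.nbr_injective s hs (congrArg Prod.snd (E.cell_injective hij))

theorem degree_eq [Fintype W] [DecidableRel G.Adj] (hd : ∀ x, G.degree x ≤ d)
    (b : B) {s : S} (hs : s ∉ E.bad) : G.degree (E.cell (b, s)) = d := by
  classical
  rw [SimpleGraph.degree, ← E.image_nbr hd b hs, Finset.card_image_of_injective,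
    Finset.card_univ, Fintype.card_fin]
  intro i j hij
  exact E.nbr_injective s hs (congrArg Prod.snd (E.cell_injective hij))

theorem exists_eq_nbr [Fintype W] [DecidableRel G.Adj] (hd : ∀ x, G.degree x ≤ d)
    {b : B} {s : S} (hs : s ∉ E.bad) {y : W} (hy : G.Adj (E.cell (b, s)) y) :
    ∃ i, y = E.cell (b, E.nbr s i) := by
  classical
  rw [← SimpleGraph.mem_neighborFinset, ← E.image_nbr hd b hs] at hy
  simpa [eq_comm] using hy

/-- The function equal to `c b * h s` at the vertex `s` of the copy `b`. -/
noncomputable def blockFun (h : S → ℝ) : (B → ℝ) →ₗ[ℝ] (W → ℝ) where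
  toFun c := Function.extend E.cell (fun p => c p.1 * h p.2) 0
  map_add' c c' := by
    rw [← Function.extend_add, add_zero]
    congr 1
    funext p
    simp [add_mul]
  map_smul' a c := by
    rw [RingHom.id_apply, ← Function.extend_smul, smul_zero]
    congr 1
    funext p
    simp [mul_assoc]

theorem blockFun_apply (h : S → ℝ) (c : B → ℝ) (x : W) :
    E.blockFun h c x = Function.extend E.cell (fun p => c p.1 * h p.2) 0 x := rfl

theorem blockFun_cell (h : S → ℝ) (c : B → ℝ) (b : B) (s : S) :
    E.blockFun h c (E.cell (b, s)) = c b * h s := by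
  rw [blockFun_apply, E.cell_injective.extend_apply]

open Classical in
/-- The square of a block function, restricted to the exceptional vertices. -/
noncomputable def badPart (c : B → ℝ) : W → ℝ :=
  Function.extend E.cell (fun p => if p.2 ∈ E.bad then c p.1 ^ 2 else 0) 0

open Classical in
theorem badPart_cell (c : B → ℝ) (b : B) (s : S) :
    E.badPart c (E.cell (b, s)) = if s ∈ E.bad then c b ^ 2 else 0 :=
  E.cell_injective.extend_apply _ _ _

theorem eq_cell_or_blockFun_sq_eq {h : S → ℝ} (hh : ∀ s, h s ^ 2 = 1) (c : B → ℝ) (x : W) :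
    (∃ b, ∃ s ∉ E.bad, x = E.cell (b, s)) ∨ E.blockFun h c x ^ 2 = E.badPart c x := by
  by_cases hx : ∃ p, E.cell p = x
  · obtain ⟨⟨b, s⟩, rfl⟩ := hx
    by_cases hs : s ∈ E.bad
    · right
      rw [blockFun_cell, badPart_cell, if_pos hs, mul_pow, hh, mul_one]
    · exact Or.inl ⟨b, s, hs, rfl⟩
  · right
    rw [badPart, blockFun_apply, Function.extend_apply' _ _ _ hx, Function.extend_apply' _ _ _ hx]
    simp

theorem badPart_nonneg (c : B → ℝ) (x : W) : 0 ≤ E.badPart c x := by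
  by_cases hx : ∃ p, E.cell p = x
  · obtain ⟨⟨b, s⟩, rfl⟩ := hx
    rw [badPart_cell]
    split_ifs <;> positivity
  · rw [badPart, Function.extend_apply' _ _ _ hx, Pi.zero_apply]

theorem sum_badPart [Fintype W] [Fintype B] [Fintype S] (c : B → ℝ) :
    ∑ x, E.badPart c x = E.bad.card * ∑ b, c b ^ 2 := by
  classical
  rw [badPart, sum_extend_zero E.cell_injective, Fintype.sum_prod_type, Finset.mul_sum]
  refine Finset.sum_congr rfl fun b _ => ?_
  simp

theorem dotProduct_blockFun [Fintype W] [Fintype B] [Fintype S] {h : S → ℝ}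
    (hh : ∀ s, h s ^ 2 = 1) (c : B → ℝ) :
    E.blockFun h c ⬝ᵥ E.blockFun h c = Fintype.card S * ∑ b, c b ^ 2 := by
  have : ∀ x, E.blockFun h c x * E.blockFun h c x =
      Function.extend E.cell (fun p => c p.1 ^ 2) 0 x := by
    intro x
    by_cases hx : ∃ p, E.cell p = x
    · obtain ⟨⟨b, s⟩, rfl⟩ := hx
      rw [blockFun_cell, E.cell_injective.extend_apply, ← sq, mul_pow, hh, mul_one]
    · rw [blockFun_apply, Function.extend_apply' _ _ _ hx, Function.extend_apply' _ _ _ hx]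
      simp
  simp only [dotProduct, this]
  rw [sum_extend_zero E.cell_injective, Fintype.sum_prod_type, Finset.mul_sum]
  simp

theorem blockFun_injective [Nonempty S] {h : S → ℝ} (hh : ∀ s, h s ^ 2 = 1) :
    Function.Injective (E.blockFun h) := by
  intro c c' hc
  funext b
  let s : S := Classical.arbitrary S
  have h1 := congrFun hc (E.cell (b, s))
  rw [blockFun_cell, blockFun_cell] at h1
  have hs : h s ≠ 0 := fun h0 => by simpa [h0] using hh s
  exact mul_right_cancel₀ hs h1

theorem finrank_range_blockFun [Fintype B] [Nonempty S] {h : S → ℝ} (hh : ∀ s, h s ^ 2 = 1) :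
    finrank ℝ (LinearMap.range (E.blockFun h)) = Fintype.card B := by
  rw [LinearMap.finrank_range_of_inj (E.blockFun_injective hh), finrank_fintype_fun_eq_card]

variable [Fintype W] [DecidableRel G.Adj]

/-- If either end is inner, the two values cancel and the left side is zero. Otherwise `badPart` is
the squared value at both ends, and `(a + τb)² ≤ 2(a² + b²)`. Constant blocks use `τ = -1`, signed
blocks `τ = 1`. -/
theorem sq_add_mul_blockFun_le (hd : ∀ x, G.degree x ≤ d) {h : S → ℝ} {τ : ℝ} (hτ : τ ^ 2 = 1)
    (hh : ∀ s, h s ^ 2 = 1) (hn : ∀ s ∉ E.bad, ∀ i, h (E.nbr s i) = -τ * h s) (c : B → ℝ) (x y : W)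
    (hxy : G.Adj x y) : (E.blockFun h c x + τ * E.blockFun h c y) ^ 2 ≤
      2 * (E.badPart c x + E.badPart c y) := by
  have key : ∀ b, ∀ s ∉ E.bad, ∀ y, G.Adj (E.cell (b, s)) y →
      E.blockFun h c y = -τ * E.blockFun h c (E.cell (b, s)) := by
    intro b s hs y hy
    obtain ⟨i, rfl⟩ := E.exists_eq_nbr hd hs hy
    rw [blockFun_cell, blockFun_cell, hn s hs]
    ring
  have hnn : 0 ≤ 2 * (E.badPart c x + E.badPart c y) :=
    mul_nonneg zero_le_two (add_nonneg (E.badPart_nonneg c x) (E.badPart_nonneg c y))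
  rcases E.eq_cell_or_blockFun_sq_eq hh c x with ⟨b, s, hs, rfl⟩ | hx
  · rw [key b s hs y hxy]
    refine le_of_eq_of_le ?_ hnn
    linear_combination (τ ^ 2 - 1) * E.blockFun h c (E.cell (b, s)) ^ 2 * hτ
  rcases E.eq_cell_or_blockFun_sq_eq hh c y with ⟨b, s, hs, rfl⟩ | hy
  · rw [key b s hs x hxy.symm]
    refine le_of_eq_of_le ?_ hnn
    ring
  · rw [← hx, ← hy]
    linear_combination 2 * E.blockFun h c y ^ 2 * hτ +
      sq_nonneg (E.blockFun h c x - τ * E.blockFun h c y)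

variable [Fintype B] [Fintype S] [Nonempty S]

theorem laplacianEigenvalue_le (hd : ∀ x, G.degree x ≤ d) (j : Fin (Fintype.card W))
    (hj : (j : ℕ) < Fintype.card B) :
    laplacianEigenvalue G j ≤ 4 * d * (E.bad.card / Fintype.card S) := by
  classical
  have hone : ∀ s : S, (fun _ : S => (1 : ℝ)) s ^ 2 = 1 := fun _ => one_pow 2
  refine _root_.laplacianEigenvalue_le G (LinearMap.range (E.blockFun fun _ => 1)) ?_ j
    (by rwa [E.finrank_range_blockFun hone])
  rintro _ ⟨c, rfl⟩
  have h1 := sum_sum_adj_le G (q := fun x y =>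
    (E.blockFun (fun _ => 1) c x - E.blockFun (fun _ => 1) c y) ^ 2) hd (E.badPart_nonneg c)
    fun x y hxy => by
      simpa [← sub_eq_add_neg] using
        E.sq_add_mul_blockFun_le hd (τ := -1) (by norm_num) hone (by simp) c x y hxy
  rw [← dotProduct_lapMatrix_mulVec, sum_badPart] at h1
  rw [E.dotProduct_blockFun hone]
  have hS : (Fintype.card S : ℝ) ≠ 0 := Nat.cast_ne_zero.2 Fintype.card_ne_zero
  have hnn : 0 ≤ (d : ℝ) * (E.bad.card * ∑ b, c b ^ 2) := by positivity
  calc _ ≤ _ := h1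
    _ ≤ 4 * d * (E.bad.card * ∑ b, c b ^ 2) := by linarith
    _ = _ := by field_simp

/-- The edges and the missing degree each cost at most `2d` times the mass on exceptional vertices.
-/
theorem le_laplacianEigenvalue (hd : ∀ x, G.degree x ≤ d) (j : Fin (Fintype.card W))
    (hj : (j.rev : ℕ) < Fintype.card B) :
    2 * d - 4 * d * (E.bad.card / Fintype.card S) ≤ laplacianEigenvalue G j := by
  classical
  refine _root_.le_laplacianEigenvalue G (LinearMap.range (E.blockFun E.sign)) ?_ j
    (by rwa [E.finrank_range_blockFun E.sign_sq])
  rintro _ ⟨c, rfl⟩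
  have h1 := sum_sum_adj_le G (q := fun x y =>
    (E.blockFun E.sign c x + E.blockFun E.sign c y) ^ 2) hd (E.badPart_nonneg c)
    fun x y hxy => by
      simpa using E.sq_add_mul_blockFun_le hd (τ := 1) (by norm_num) E.sign_sq
        (by simpa using E.sign_nbr) c x y hxy
  have h2 : ∑ x, 2 * ((d : ℝ) - G.degree x) * E.blockFun E.sign c x ^ 2 ≤
      2 * d * ∑ x, E.badPart c x := by
    rw [Finset.mul_sum]
    refine Finset.sum_le_sum fun x _ => ?_
    have hnn := E.badPart_nonneg c x
    rcases E.eq_cell_or_blockFun_sq_eq E.sign_sq c x with ⟨b, s, hs, rfl⟩ | hx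
    · rw [E.degree_eq hd b hs, sub_self]
      simp only [mul_zero, zero_mul]
      positivity
    · rw [hx]
      refine mul_le_mul_of_nonneg_right ?_ hnn
      have : (0 : ℝ) ≤ G.degree x := Nat.cast_nonneg _
      linarith
  have h3 := signless_quadraticForm G d (E.blockFun E.sign c)
  rw [sum_badPart] at h1 h2
  rw [E.dotProduct_blockFun E.sign_sq] at h3 ⊢
  have hS : (Fintype.card S : ℝ) ≠ 0 := Nat.cast_ne_zero.2 Fintype.card_ne_zero
  have h4 : 4 * (d : ℝ) * (E.bad.card / Fintype.card S) * (Fintype.card S * ∑ b, c b ^ 2) =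
      4 * d * (E.bad.card * ∑ b, c b ^ 2) := by field_simp
  rw [sub_mul, h4]
  linarith

end BlockFamily

theorem BlockFamily.eigenvaluesTendTo {W : ℕ → Type*} [∀ k, Fintype (W k)]
    (G : ∀ k, SimpleGraph (W k)) [∀ k, DecidableRel (G k).Adj] {d : ℕ}
    (hd : ∀ k x, (G k).degree x ≤ d) (S : ℕ → Type*) [∀ n, Fintype (S n)]
    (E : ∀ n k, 0 < n → BlockFamily (G k) d (Fin (k / (2 * n)) × Fin (k / (2 * n))) (S n))
    (hS : ∀ n, 0 < n → Nonempty (S n))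
    (hbad : ∀ n k hn, (E n k hn).bad.card * n ≤ 4 * Fintype.card (S n))
    (m : ℕ → ℕ) (hm : Tendsto (fun k : ℕ => (m k : ℝ) / (k : ℝ) ^ 2) atTop (𝓝 0)) :
    FirstEigenvaluesTendTo G m 0 ∧ LastEigenvaluesTendTo G m (2 * d) := by
  have key : ∀ ε > 0, ∃ n : ℕ, ∃ hn : 0 < n, (∀ k,
      4 * (d : ℝ) * ((E n k hn).bad.card / Fintype.card (S n)) < ε) ∧
      ∀ᶠ k in atTop, m k < k / (2 * n) * (k / (2 * n)) := by
    intro ε hε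
    -- The ratio of exceptional vertices is at most `4 / n`, so the error is at most `4d · 4 / n`.
    obtain ⟨n, hn⟩ := exists_nat_gt (16 * d / ε)
    have hn0' : (0 : ℝ) < n := lt_of_le_of_lt (by positivity) hn
    have hn0 : 0 < n := Nat.cast_pos.1 hn0'
    refine ⟨n, hn0, fun k => ?_, ?_⟩
    · have := hS n hn0
      have hc : (0 : ℝ) < Fintype.card (S n) := Nat.cast_pos.2 Fintype.card_pos
      have h1 : ((E n k hn0).bad.card : ℝ) * n ≤ 4 * Fintype.card (S n) := by
        exact_mod_cast hbad n k hn0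
      have h2 : ((E n k hn0).bad.card : ℝ) / Fintype.card (S n) ≤ 4 / n := by
        rw [div_le_div_iff₀ hc hn0']
        exact h1
      rw [div_lt_iff₀ hε] at hn
      calc _ ≤ 4 * (d : ℝ) * (4 / n) := mul_le_mul_of_nonneg_left h2 (by positivity)
        _ = 16 * d / n := by ring
        _ < ε := by rw [div_lt_iff₀ hn0']; linarith
    -- For `k ≥ 2n` rounding down at most halves: `k ≤ 4n⌊k / (2n)⌋`, so there are at least `k² /
    -- (16n²)` blocks.
    · filter_upwards [hm.eventually_lt_const (show (0 : ℝ) < 1 / (16 * n ^ 2) by positivity),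
        eventually_ge_atTop (2 * n)] with k hk hkn
      have hk0 : (0 : ℝ) < k := Nat.cast_pos.2 (by omega)
      rw [div_lt_div_iff₀ (by positivity) (by positivity), one_mul] at hk
      have hk' : m k * (16 * n ^ 2) < k ^ 2 := by exact_mod_cast hk
      have h1 : 1 ≤ k / (2 * n) := (Nat.one_le_div_iff (by omega)).2 hkn
      have h2 : k < 2 * n * (k / (2 * n) + 1) := Nat.lt_mul_div_succ k (by omega)
      have h3 : k ≤ 4 * n * (k / (2 * n)) := by nlinarith
      have h4 : k ^ 2 ≤ (4 * n * (k / (2 * n))) ^ 2 := Nat.pow_le_pow_left h3 2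
      refine Nat.lt_of_mul_lt_mul_right (a := 16 * n ^ 2) (hk'.trans_le (h4.trans_eq ?_))
      ring
  constructor
  · intro ε hε
    obtain ⟨n, hn, hlt, hev⟩ := key ε hε
    filter_upwards [hev] with k hk j hj
    have := hS n hn
    have h := (E n k hn).laplacianEigenvalue_le (hd k) j (by simpa using hj.trans hk)
    rw [sub_zero, abs_of_nonneg (laplacianEigenvalue_nonneg _ _)]
    exact h.trans_lt (hlt k)
  · intro ε hε
    obtain ⟨n, hn, hlt, hev⟩ := key ε hε
    filter_upwards [hev] with k hk j hj
    have := hS n hn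
    have h := (E n k hn).le_laplacianEigenvalue (hd k) j (by simpa using hj.trans hk)
    have h' := laplacianEigenvalue_le_two_mul (G k) (hd k) j
    rw [abs_lt]
    constructor <;> linarith [hlt k]

/-! ### Degrees and blocks in glued tiles -/

/-- If the neighbours of each vertex can be told apart by `d` directions, the degrees are at most
`d`. -/
theorem SimpleGraph.degree_le_of_functional {W : Type*} (G : SimpleGraph W) {d : ℕ}
    (R : Fin d → W → W → Prop) (hR : ∀ x y, G.Adj x y → ∃ i, R i x y)
    (hunique : ∀ i x y z, R i x y → R i x z → y = z) (x : W) [Fintype (G.neighborSet x)] :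
    G.degree x ≤ d := by
  classical
  have h : ∀ y : G.neighborSet x, ∃ i, R i x y := fun y => hR x y y.2
  choose i hi using h
  rw [← SimpleGraph.card_neighborSet_eq_degree, ← Fintype.card_fin d]
  refine Fintype.card_le_of_injective i fun y z hyz => Subtype.ext ?_
  exact hunique _ _ _ _ (hi y) (hyz ▸ hi z)

/-- Direction `i` means a step inside the tile or a crossing of side `i`. By `hside` a cell on side
`i` has no inner step in that direction, so the two never compete; a crossing is determined by `i`
and the cell. -/
theorem glueTiles_degree_le {V : Type*} {X : SimpleGraph V} {d k : ℕ} (o : VertexOrientation X d)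
    {C : Type*} (T : SimpleGraph C) (side : Fin d → Fin k → C) (step : Fin d → C → C → Prop)
    (hT : ∀ c c', T.Adj c c' → ∃ i, step i c c')
    (hunique : ∀ i c c' c'', step i c c' → step i c c'' → c' = c'')
    (hside : ∀ i t c, ¬ step i (side i t) c) (hinj : ∀ i, Function.Injective (side i))
    (x : V × C) [Fintype ((glueTiles o T side).neighborSet x)] :
    (glueTiles o T side).degree x ≤ d := by
  refine SimpleGraph.degree_le_of_functional _ (fun i x y => (x.1 = y.1 ∧ step i x.2 y.2) ∨
      ∃ (j : Fin d) (t : Fin k), (o.nbr x.1 i : V) = y.1 ∧ (o.nbr y.1 j : V) = x.1 ∧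
        x.2 = side i t ∧ y.2 = side j t.rev) ?_ ?_ x
  · rintro x y (⟨h, h'⟩ | ⟨i, j, t, h⟩)
    · obtain ⟨i, hi⟩ := hT _ _ h'
      exact ⟨i, Or.inl ⟨h, hi⟩⟩
    · exact ⟨i, Or.inr ⟨j, t, h⟩⟩
  · rintro i ⟨p, c⟩ ⟨q, c'⟩ ⟨r, c''⟩ (⟨h, h'⟩ | ⟨j, t, h₁, h₂, h₃, h₄⟩)
      (⟨g, g'⟩ | ⟨l, u, g₁, g₂, g₃, g₄⟩)
    · exact Prod.ext (h.symm.trans g) (hunique _ _ _ _ h' g')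
    · dsimp only at h' g₃
      exact absurd (g₃ ▸ h') (hside _ _ _)
    · dsimp only at g' h₃
      exact absurd (h₃ ▸ g') (hside _ _ _)
    · dsimp only at h₁ h₂ h₃ h₄ g₁ g₂ g₃ g₄
      obtain rfl := h₁.symm.trans g₁ |>.symm
      have hjl : j = l := (o.nbr _).injective (Subtype.ext (h₂.trans g₂.symm))
      have htu : t = u := hinj i (h₃.symm.trans g₃)
      rw [h₄, g₄, hjl, htu]

/-- A block family in a tile gives one in the graph glued from tiles. -/
def BlockFamily.glueTiles {V : Type*} {X : SimpleGraph V} {d k : ℕ} (o : VertexOrientation X d)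
    {C : Type*} {T : SimpleGraph C} (side : Fin d → Fin k → C) (p : V) {B S : Type*}
    (E : BlockFamily T d B S) : BlockFamily (glueTiles o T side) d B S where
  cell b := (p, E.cell b)
  cell_injective _ _ h := E.cell_injective (congrArg Prod.snd h)
  sign := E.sign
  sign_sq := E.sign_sq
  bad := E.bad
  nbr := E.nbr
  nbr_injective := E.nbr_injective
  adj b s hs i := Or.inl ⟨rfl, E.adj b s hs i⟩
  sign_nbr := E.sign_nbr

/-- The factor `2` serves the triangle: two such coordinates and a margin of `2` together fit into
`k`. -/
theorem mul_add_lt_of_lt_div {n k a i : ℕ} (ha : a < k / (2 * n)) (hi : i < n) :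
    2 * (n * a + i) + 2 ≤ k := by
  have h : 2 * n * (k / (2 * n)) ≤ k := Nat.mul_div_le k (2 * n)
  have : 2 * n * (a + 1) ≤ 2 * n * (k / (2 * n)) := Nat.mul_le_mul_left _ ha
  linarith

theorem eq_and_eq_of_mul_add_eq {n a b i j : ℕ} (hi : i < n) (hj : j < n)
    (h : n * a + i = n * b + j) : a = b ∧ i = j := by
  have h1 : (n * a + i) / n = a := by
    rw [Nat.mul_add_div (by omega), Nat.div_eq_of_lt hi, add_zero]
  have h2 : (n * b + j) / n = b := by
    rw [Nat.mul_add_div (by omega), Nat.div_eq_of_lt hj, add_zero]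
  have hab : a = b := by rw [← h1, h, h2]
  subst hab
  exact ⟨rfl, by omega⟩

/-! ### Blocks in the square -/

section Square

/-- The four unit steps in the square grid, numbered like the sides of the square. -/
def squareStep {k : ℕ} (i : Fin 4) (c c' : SquareCell k) : Prop :=
  ![(c'.1 : ℕ) = c.1 + 1 ∧ c'.2 = c.2, (c'.2 : ℕ) = c.2 + 1 ∧ c'.1 = c.1,
    (c.1 : ℕ) = c'.1 + 1 ∧ c'.2 = c.2, (c.2 : ℕ) = c'.2 + 1 ∧ c'.1 = c.1] i

theorem squareTile_adj_iff {k : ℕ} (c c' : SquareCell k) :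
    (squareTile k).Adj c c' ↔ ∃ i, squareStep i c c' := by
  simp only [squareTile, SimpleGraph.boxProd_adj, SimpleGraph.pathGraph_adj, Fin.exists_fin_succ,
    squareStep, Fin.ext_iff]
  simp
  omega

theorem goldbergCoxeter4_degree_le {V : Type*} {X : SimpleGraph V} (o : VertexOrientation X 4)
    (k : ℕ) (x : V × SquareCell k) [Fintype ((goldbergCoxeter4 o k).neighborSet x)] :
    (goldbergCoxeter4 o k).degree x ≤ 4 := by
  unfold goldbergCoxeter4 at *
  refine glueTiles_degree_le o _ _ squareStep (fun c c' => (squareTile_adj_iff c c').1) ?_ ?_ ?_ x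
  · rintro i ⟨a, b⟩ ⟨a', b'⟩ ⟨a'', b''⟩ h h'
    fin_cases i <;> simp [squareStep, Fin.ext_iff] at h h' ⊢ <;> omega
  · rintro i t ⟨a, b⟩ h
    fin_cases i <;> simp [squareStep, squareSide, Fin.ext_iff] at h <;> omega
  · intro i t u h
    fin_cases i <;> simpa [squareSide] using h

/-- The square blocks of side `n` in the `k × k` grid. -/
def squareBlocks (n k : ℕ) (hn : 0 < n) : BlockFamily (squareTile k) 4
    (Fin (k / (2 * n)) × Fin (k / (2 * n))) (Fin n × Fin n) where
  cell q := (⟨n * q.1.1 + q.2.1, by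
      have := mul_add_lt_of_lt_div q.1.1.isLt q.2.1.isLt; omega⟩,
    ⟨n * q.1.2 + q.2.2, by have := mul_add_lt_of_lt_div q.1.2.isLt q.2.2.isLt; omega⟩)
  cell_injective := by
    rintro ⟨⟨A, B⟩, ⟨i, j⟩⟩ ⟨⟨A', B'⟩, ⟨i', j'⟩⟩ h
    simp only [Prod.mk.injEq, Fin.mk.injEq] at h
    have h1 := eq_and_eq_of_mul_add_eq i.isLt i'.isLt h.1
    have h2 := eq_and_eq_of_mul_add_eq j.isLt j'.isLt h.2
    simp only [Prod.mk.injEq, Fin.ext_iff]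
    exact ⟨⟨h1.1, h2.1⟩, h1.2, h2.2⟩
  sign s := (-1) ^ ((s.1 : ℕ) + s.2)
  sign_sq s := by rw [← pow_mul, mul_comm, pow_mul]; norm_num
  bad := {s | (s.1 : ℕ) = 0 ∨ (s.1 : ℕ) + 1 = n ∨ (s.2 : ℕ) = 0 ∨ (s.2 : ℕ) + 1 = n}
  -- The reduction mod `n` and the truncated subtraction take effect only at exceptional cells,
  -- where the value is irrelevant.
  nbr s := ![(⟨(s.1 + 1) % n, Nat.mod_lt _ hn⟩, s.2), (s.1, ⟨(s.2 + 1) % n, Nat.mod_lt _ hn⟩),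
    (⟨s.1 - 1, by omega⟩, s.2), (s.1, ⟨s.2 - 1, by omega⟩)]
  nbr_injective := by
    rintro ⟨i, j⟩ hs a b hab
    simp only [Finset.mem_filter_univ, not_or] at hs
    have hi := Nat.mod_eq_of_lt (show (i : ℕ) + 1 < n by omega)
    have hj := Nat.mod_eq_of_lt (show (j : ℕ) + 1 < n by omega)
    fin_cases a <;> fin_cases b <;> simp [hi, hj, Fin.ext_iff] at hab ⊢ <;> omega
  adj := by
    rintro ⟨A, B⟩ ⟨i, j⟩ hs a
    simp only [Finset.mem_filter_univ, not_or] at hs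
    have hi := Nat.mod_eq_of_lt (show (i : ℕ) + 1 < n by omega)
    have hj := Nat.mod_eq_of_lt (show (j : ℕ) + 1 < n by omega)
    rw [squareTile_adj_iff]
    refine ⟨a, ?_⟩
    fin_cases a <;> simp [squareStep, hi, hj, Fin.ext_iff] <;> omega
  sign_nbr := by
    rintro ⟨i, j⟩ hs a
    simp only [Finset.mem_filter_univ, not_or] at hs
    have hi := Nat.mod_eq_of_lt (show (i : ℕ) + 1 < n by omega)
    have hj := Nat.mod_eq_of_lt (show (j : ℕ) + 1 < n by omega)
    obtain ⟨i', hi'⟩ := Nat.exists_eq_succ_of_ne_zero hs.1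
    obtain ⟨j', hj'⟩ := Nat.exists_eq_succ_of_ne_zero hs.2.2.1
    fin_cases a <;> simp [hi, hj] <;> simp [hi', hj', pow_succ, pow_add]

theorem squareBlocks_bad_card_le (n k : ℕ) (hn : 0 < n) :
    (squareBlocks n k hn).bad.card ≤ 4 * n := by
  have h : (squareBlocks n k hn).bad ⊆ Finset.univ.image fun q : Fin 4 × Fin n =>
      (![(⟨0, hn⟩, q.2), (⟨n - 1, by omega⟩, q.2), (q.2, ⟨0, hn⟩),
        (q.2, ⟨n - 1, by omega⟩)] q.1 : Fin n × Fin n) := by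
    rintro ⟨i, j⟩ hs
    simp only [squareBlocks, Finset.mem_filter_univ] at hs
    simp only [Finset.mem_image, Finset.mem_univ, true_and, Prod.exists, Fin.exists_fin_succ]
    rcases hs with h | h | h | h
    · exact Or.inl ⟨j, by simp [Fin.ext_iff, h]⟩
    · exact Or.inr (Or.inl ⟨j, by simp [← h]⟩)
    · exact Or.inr (Or.inr (Or.inl ⟨i, by simp [Fin.ext_iff, h]⟩))
    · exact Or.inr (Or.inr (Or.inr (Or.inl ⟨i, by simp [← h]⟩)))
  refine (Finset.card_le_card h).trans (Finset.card_image_le.trans ?_)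
  simp

end Square

/-! ### Blocks in the triangle -/

section Triangle

/-- The two triangles differ by one in the `i`-th integer part, and agree in the others. -/
def triStep {k : ℕ} (i : Fin 3) (c c' : TriCell k) : Prop :=
  (∀ j, (c'.1 j : ℕ) = (c.1 j : ℕ) + if j = i then 1 else 0) ∨
    ∀ j, (c.1 j : ℕ) = (c'.1 j : ℕ) + if j = i then 1 else 0

theorem triTile_adj_iff {k : ℕ} (c c' : TriCell k) :
    (triTile k).Adj c c' ↔ ∃ i, triStep i c c' := by
  rw [triTile, SimpleGraph.fromRel_adj, ← exists_or, and_iff_right_of_imp]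
  · rfl
  · rintro ⟨i, h | h⟩ rfl <;> simpa using h i

theorem goldbergCoxeter3_degree_le {V : Type*} {X : SimpleGraph V} (o : VertexOrientation X 3)
    (k : ℕ) (x : V × TriCell k) [Fintype ((goldbergCoxeter3 o k).neighborSet x)] :
    (goldbergCoxeter3 o k).degree x ≤ 3 := by
  unfold goldbergCoxeter3 at *
  refine glueTiles_degree_le o _ _ triStep (fun c c' => (triTile_adj_iff c c').1) ?_ ?_ ?_ x
  -- The coordinate sum fixes the sign of a step: upward triangles can only decrease a coordinate,
  -- downward ones only increase it.
  · rintro i ⟨c, hc⟩ ⟨c', hc'⟩ ⟨c'', hc''⟩ h h'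
    simp only [triStep, Fin.forall_fin_succ] at h h'
    simp only [Fin.sum_univ_three] at hc hc' hc''
    refine Subtype.ext (funext fun j => Fin.ext ?_)
    fin_cases i <;> fin_cases j <;> simp at h h' ⊢ <;> omega
  -- A side cell is upward with `x i = 0`, so `x i` cannot decrease.
  · rintro i t ⟨c, hc⟩ h
    simp only [triStep, triSide, Fin.forall_fin_succ] at h
    simp only [Fin.sum_univ_three] at hc
    fin_cases i <;> simp at h <;> omega
  · intro i t u h
    have h := congrFun (congrArg Subtype.val h) (i + 2)
    fin_cases i <;> simpa [triSide] using h

/-- The upward and downward triangles in the rhombic blocks of side `n` at the corner `0` of the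
triangle of side `k`. -/
def triBlocks (n k : ℕ) (hn : 0 < n) : BlockFamily (triTile k) 3
    (Fin (k / (2 * n)) × Fin (k / (2 * n))) (Fin n × Fin n × Bool) where
  cell q :=
    have h₁ := mul_add_lt_of_lt_div q.1.1.isLt q.2.1.isLt
    have h₂ := mul_add_lt_of_lt_div q.1.2.isLt q.2.2.1.isLt
    -- The other two coordinates and the orientation (`true` for upward) force this one.
    ⟨![⟨k - (n * q.1.1 + q.2.1) - (n * q.1.2 + q.2.2.1) - if q.2.2.2 then 1 else 2, by
        split_ifs <;> omega⟩,
      ⟨n * q.1.1 + q.2.1, by omega⟩, ⟨n * q.1.2 + q.2.2.1, by omega⟩], by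
        simp only [Fin.sum_univ_three, Matrix.cons_val]
        split_ifs <;> omega⟩
  cell_injective := by
    rintro ⟨⟨A, B⟩, ⟨i, j, u⟩⟩ ⟨⟨A', B'⟩, ⟨i', j', u'⟩⟩ h
    have h₁ := mul_add_lt_of_lt_div A.isLt i.isLt
    have h₂ := mul_add_lt_of_lt_div B.isLt j.isLt
    have h := congrArg Subtype.val h
    have e0 := Fin.ext_iff.1 (congrFun h 0)
    have e1 := Fin.ext_iff.1 (congrFun h 1)
    have e2 := Fin.ext_iff.1 (congrFun h 2)
    simp only [Matrix.cons_val] at e0 e1 e2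
    have f1 := eq_and_eq_of_mul_add_eq i.isLt i'.isLt e1
    have f2 := eq_and_eq_of_mul_add_eq j.isLt j'.isLt e2
    have hu : u = u' := by
      rw [← e1, ← e2] at e0
      revert e0
      cases u <;> cases u' <;> simp <;> omega
    simp only [Prod.mk.injEq, Fin.ext_iff]
    exact ⟨⟨f1.1, f2.1⟩, f1.2, f2.2, hu⟩
  sign s := if s.2.2 then 1 else -1
  sign_sq s := by split_ifs <;> norm_num
  -- Upward triangles leave the block only by decreasing a block coordinate, downward ones only by
  -- increasing it.
  bad := {s | if s.2.2 then (s.1 : ℕ) = 0 ∨ (s.2.1 : ℕ) = 0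
    else (s.1 : ℕ) + 1 = n ∨ (s.2.1 : ℕ) + 1 = n}
  nbr s := if s.2.2 then ![(s.1, s.2.1, false), (⟨s.1 - 1, by omega⟩, s.2.1, false),
      (s.1, ⟨s.2.1 - 1, by omega⟩, false)]
    else ![(s.1, s.2.1, true), (⟨(s.1 + 1) % n, Nat.mod_lt _ hn⟩, s.2.1, true),
      (s.1, ⟨(s.2.1 + 1) % n, Nat.mod_lt _ hn⟩, true)]
  nbr_injective := by
    rintro ⟨i, j, u⟩ hs a b hab
    simp only [Finset.mem_filter_univ] at hs
    cases u
    · simp only [Bool.false_eq_true, if_false, not_or] at hs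
      have hi := Nat.mod_eq_of_lt (show (i : ℕ) + 1 < n by omega)
      have hj := Nat.mod_eq_of_lt (show (j : ℕ) + 1 < n by omega)
      fin_cases a <;> fin_cases b <;> simp [hi, hj, Fin.ext_iff] at hab ⊢
    · simp only [if_true, not_or] at hs
      fin_cases a <;> fin_cases b <;> simp [Fin.ext_iff] at hab ⊢ <;> omega
  adj := by
    rintro ⟨A, B⟩ ⟨i, j, u⟩ hs a
    have h₁ := mul_add_lt_of_lt_div A.isLt i.isLt
    have h₂ := mul_add_lt_of_lt_div B.isLt j.isLt
    simp only [Finset.mem_filter_univ] at hs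
    rw [triTile_adj_iff]
    refine ⟨a, ?_⟩
    simp only [triStep, Fin.forall_fin_succ]
    cases u
    · left
      simp only [Bool.false_eq_true, if_false, not_or] at hs
      have hi := Nat.mod_eq_of_lt (show (i : ℕ) + 1 < n by omega)
      have hj := Nat.mod_eq_of_lt (show (j : ℕ) + 1 < n by omega)
      fin_cases a <;> simp [hi, hj] <;> omega
    · right
      simp only [if_true, not_or] at hs
      fin_cases a <;> simp <;> omega
  sign_nbr := by
    rintro ⟨i, j, u⟩ hs a
    cases u <;> fin_cases a <;> simp

theorem triBlocks_bad_card_le (n k : ℕ) (hn : 0 < n) :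
    (triBlocks n k hn).bad.card ≤ 4 * n := by
  have h : (triBlocks n k hn).bad ⊆ Finset.univ.image fun q : Fin 4 × Fin n =>
      (![(⟨0, hn⟩, q.2, true), (q.2, ⟨0, hn⟩, true), (⟨n - 1, by omega⟩, q.2, false),
        (q.2, ⟨n - 1, by omega⟩, false)] q.1 : Fin n × Fin n × Bool) := by
    rintro ⟨i, j, u⟩ hs
    simp only [triBlocks, Finset.mem_filter_univ] at hs
    simp only [Finset.mem_image, Finset.mem_univ, true_and, Prod.exists, Fin.exists_fin_succ]
    cases u
    · simp only [Bool.false_eq_true, if_false] at hs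
      rcases hs with h | h
      · exact Or.inr (Or.inr (Or.inl ⟨j, by simp [← h]⟩))
      · exact Or.inr (Or.inr (Or.inr (Or.inl ⟨i, by simp [← h]⟩)))
    · simp only [if_true] at hs
      rcases hs with h | h
      · exact Or.inl ⟨j, by simp [Fin.ext_iff, h]⟩
      · exact Or.inr (Or.inl ⟨i, by simp [Fin.ext_iff, h]⟩)
  refine (Finset.card_le_card h).trans (Finset.card_image_le.trans ?_)
  simp

end Triangle

/-! ### The theorem -/

theorem theorem1p1 {V : Type*} [Fintype V] (X : SimpleGraph V) (hX : X.Connected)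
    (m : ℕ → ℕ) (hm : Tendsto (fun k : ℕ => (m k : ℝ) / (k : ℝ) ^ 2) atTop (𝓝 0)) :
    (∀ o : VertexOrientation X 3,
      FirstEigenvaluesTendTo (fun k => goldbergCoxeter3 o k) m 0 ∧
        LastEigenvaluesTendTo (fun k => goldbergCoxeter3 o k) m 6) ∧
    (∀ o : VertexOrientation X 4,
      FirstEigenvaluesTendTo (fun k => goldbergCoxeter4 o k) m 0 ∧
        LastEigenvaluesTendTo (fun k => goldbergCoxeter4 o k) m 8) := by
  classical
  -- One tile already holds enough blocks, so any vertex will do.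
  obtain ⟨p⟩ := hX.nonempty
  refine ⟨fun o => ?_, fun o => ?_⟩
  · have := BlockFamily.eigenvaluesTendTo (fun k => goldbergCoxeter3 o k)
      (fun k x => goldbergCoxeter3_degree_le o k x) (fun n => Fin n × Fin n × Bool)
      (fun n k hn => (triBlocks n k hn).glueTiles o (triSide k) p)
      (fun n hn => ⟨⟨0, hn⟩, ⟨0, hn⟩, true⟩)
      (fun n k hn => by
        have := Nat.mul_le_mul_right n (triBlocks_bad_card_le n k hn)
        simp only [Fintype.card_prod, Fintype.card_fin, Fintype.card_bool]
        change (triBlocks n k hn).bad.card * n ≤ _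
        nlinarith) m hm
    norm_num at this
    exact this
  · have := BlockFamily.eigenvaluesTendTo (fun k => goldbergCoxeter4 o k)
      (fun k x => goldbergCoxeter4_degree_le o k x) (fun n => Fin n × Fin n)
      (fun n k hn => (squareBlocks n k hn).glueTiles o (squareSide k) p)
      (fun n hn => ⟨⟨0, hn⟩, ⟨0, hn⟩⟩)
      (fun n k hn => by
        have := Nat.mul_le_mul_right n (squareBlocks_bad_card_le n k hn)
        simp only [Fintype.card_prod, Fintype.card_fin]
        rwa [mul_assoc] at this) m hm
    norm_num at this
    exact this
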